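/- For a real $2\times2\times2$ tensor $T=(a_{ijk})_{0\le i,j,k\le 1}$ and $i\in\{1,2,3\}$, let $M_i$ be the $i$th principal flattening of $T$ (the $2\times4$ matrix whose two rows correspond to the values of the $i$th index and whose columns correspond to the values of the other two indices), and let $d_i=\det(M_iM_i^{T})$ be the $i$th Gram determinant. Let $\mathcal G(T)=(d_1,d_2,d_3)$ and $\mathcal B=\{T:\sum_{i,j,k}a_{ijk}^2\le 1\}$. For $d\in\mathbb R^3$ with nonnegative coordinates put $$Q_1(d)=\prod_{i=1}^3\Big(\sum_{j\ne i}d_j-d_i\Big),$$ $$Q_2(d)=\frac12\prod_{\epsilon\in\{\pm1\}^3}\big(\epsilon_1\sqrt{d_1}+\epsilon_2\sqrt{d_2}+\epsilon_3\sqrt{d_3}\big)=\frac12\big(d_1^2+d_2^2+d_3^2-2(d_1d_2+d_1d_3+d_2d_3)\big)^2 .$$ Then the Gram locus $\mathcal G(\mathcal B)$ is the set of all $d\in[0,\tfrac14]^3$ that satisfy at least one of the following two conditions: 1. $Q_1(d)\ge Q_2(d)$; 2. $Q_1(d)\le Q_2(d)$ and $(d_i-d_j)^2+\tfrac12(d_i+d_j)\ge\tfrac3{16}$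 for all $\{i,j\}\subset\{1,2,3\}$ with $i\ne j$. -/

import Mathlib

open scoped Matrix

noncomputable section

namespace GramLocus

/-- A real binary tensor of format `2 × 2 × ⋯ × 2` (`n` times), given by its array of entries. -/
abbrev BinaryTensor (n : ℕ) : Type := (Fin n → Fin 2) → ℝ

/-- The `i`-th principal flattening: two rows, indexed by the value of the `i`-th index,
and `2 ^ (n - 1)` columns, indexed by the values of all the other indices. -/
def flattening {n : ℕ} (T : BinaryTensor n) (i : Fin n) :
    Matrix (Fin 2) ({j : Fin n // j ≠ i} → Fin 2) ℝ :=
  Matrix.of fun r c => T fun j => if h : j = i then r else c ⟨j, h⟩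

/-- The tuple of Gram determinants of `T`: the `i`-th one is `det (M * Mᵀ)`,
where `M` is the `i`-th principal flattening. -/
def gramMap {n : ℕ} (T : BinaryTensor n) : Fin n → ℝ :=
  fun i => (flattening T i * (flattening T i)ᵀ).det

/-- The closed unit ball of tensors for the Frobenius norm. -/
def unitBall (n : ℕ) : Set (BinaryTensor n) :=
  {T | ∑ a, T a ^ 2 ≤ 1}

/-- The Gram locus: the set of tuples of Gram determinants of tensors in the unit ball. -/
def gramLocus (n : ℕ) : Set (Fin n → ℝ) :=
  gramMap '' unitBall n

/-- The product of the linear forms `∑_{j ≠ i} d_j - d_i`. -/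
def Q₁ {n : ℕ} (d : Fin n → ℝ) : ℝ :=
  ∏ i, (∑ j ∈ Finset.univ.erase i, d j - d i)

/-- Half the product, over all `2 ^ n` choices of signs, of `± √d_1 ± √d_2 ± ⋯ ± √d_n`. -/
def Q₂ {n : ℕ} (d : Fin n → ℝ) : ℝ :=
  (1 / 2) * ∏ ε : Fin n → ℤˣ, ∑ i, ((ε i : ℤ) : ℝ) * √(d i)

end GramLocus

end

open scoped Matrix

namespace GramLocus

/-! Under SO(2)³ a tensor splits into four complex weight components. In terms of their squared
moduli rᵢ and of P, twice the real part of their product, the Gram determinants are polynomials, and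
the only constraints are rᵢ ≥ 0 and P² ≤ 4r₀r₁r₂r₃ (`exists_param`, `exists_tensor`). Take norm 1,
lᵢ = ∑_{j≠i} dⱼ - dᵢ, g = `heron`, c = `threshold`. With ζ = 4P - 1/2 + ∑ dᵢ each ζ + lᵢ is half the
square of a signed sum of the r's, and the constraint on P leads to F(ζ) = 2∏(ζ + lᵢ) - (ζ² + ζ -
g)² ≥ 0. This quartic is even: F(ζ) = -ζ⁴ + 2cζ² + 2(Q₁ - Q₂) = ∏(1 - 4dᵢ)/4 - (ζ² - c)². If Q₁ ≥
Q₂, then ζ = 0 works. Otherwise c ≥ 0 is necessary and, given the triangle inequalities lᵢ ≥ 0,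
sufficient in the cube, via ζ = √c. `threshold_le` and `threshold_nonneg_or_eq` trade c ≥ 0 for the
pairwise inequalities. -/

/-- The quadratic form in the factorization `Q₂ = heron ^ 2 / 2`. -/
def heron (x y z : ℝ) : ℝ := x ^ 2 + y ^ 2 + z ^ 2 - 2 * (x * y + x * z + y * z)

theorem Q₁_three (d : Fin 3 → ℝ) :
    Q₁ d = (d 1 + d 2 - d 0) * (d 0 + d 2 - d 1) * (d 0 + d 1 - d 2) := by
  simp only [Q₁, Fin.prod_univ_three, Finset.sum_erase_eq_sub (Finset.mem_univ _),
    Fin.sum_univ_three]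
  ring

theorem prod_intUnits (f : ℤˣ → ℝ) : ∏ e, f e = f 1 * f (-1) := by
  rw [show (Finset.univ : Finset ℤˣ) = {1, -1} from rfl, Finset.prod_pair (by decide)]

theorem prod_cons {n : ℕ} (f : (Fin (n + 1) → ℤˣ) → ℝ) :
    ∏ ε, f ε = ∏ a : ℤˣ, ∏ ε : Fin n → ℤˣ, f (Fin.cons a ε) := by
  rw [← Fintype.prod_prod_type', ← (Fin.consEquiv fun _ : Fin (n + 1) => ℤˣ).prod_comp]
  rfl

theorem Q₂_three (d : Fin 3 → ℝ) (hd : ∀ i, 0 ≤ d i) :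
    Q₂ d = heron (d 0) (d 1) (d 2) ^ 2 / 2 := by
  simp only [Q₂, prod_cons, prod_intUnits, Fin.sum_univ_succ]
  simp only [Fin.cons_zero, Fin.cons_succ, Finset.univ_eq_empty, Finset.sum_empty,
    Finset.univ_unique, Finset.prod_const, Finset.card_singleton, pow_one]
  have h0 := Real.sq_sqrt (hd 0)
  have h1 := Real.sq_sqrt (hd 1)
  have h2 := Real.sq_sqrt (hd 2)
  rw [show Fin.succ (0 : Fin 2) = 1 from rfl, show Fin.succ (Fin.succ (0 : Fin 1)) = 2 from rfl]
  set a := √(d 0)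
  set b := √(d 1)
  set c := √(d 2)
  rw [heron, ← h0, ← h1, ← h2]
  push_cast
  ring

/-! ### Gram determinants in coordinates -/

theorem gramMatrix_apply {n : ℕ} (T : BinaryTensor (n + 1)) (i : Fin (n + 1)) (r s : Fin 2) :
    (flattening T i * (flattening T i)ᵀ) r s =
      ∑ a : Fin n → Fin 2, T (i.insertNth r a) * T (i.insertNth s a) := by
  rw [Matrix.mul_apply, ← ((finSuccAboveEquiv i).arrowCongr (Equiv.refl (Fin 2))).sum_comp]
  have key : ∀ (q : Fin 2) (a : Fin n → Fin 2), flattening T i q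
      ((finSuccAboveEquiv i).arrowCongr (Equiv.refl (Fin 2)) a) = T (i.insertNth q a) := by
    intro q a
    simp only [flattening, Matrix.of_apply]
    congr 1
    funext j
    refine Fin.succAboveCases i ?_ (fun k => ?_) j
    · simp
    · have h : (⟨i.succAbove k, Fin.succAbove_ne i k⟩ : {j : Fin (n + 1) // j ≠ i}) =
        finSuccAboveEquiv i k := rfl
      rw [dif_neg (Fin.succAbove_ne i k), Fin.insertNth_apply_succAbove, h]
      simp [Equiv.arrowCongr]
  simp only [Matrix.transpose_apply, key]

theorem sum_finTwoArrow (f : (Fin 2 → Fin 2) → ℝ) :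
    ∑ a, f a = f ![0, 0] + f ![0, 1] + f ![1, 0] + f ![1, 1] := by
  rw [← (finTwoArrowEquiv (Fin 2)).symm.sum_comp, Fintype.sum_prod_type]
  simp [Fin.sum_univ_two, finTwoArrowEquiv, add_assoc]

theorem sum_finThreeArrow (f : (Fin 3 → Fin 2) → ℝ) :
    ∑ a, f a = f ![0, 0, 0] + f ![0, 0, 1] + f ![0, 1, 0] + f ![0, 1, 1] +
      (f ![1, 0, 0] + f ![1, 0, 1] + f ![1, 1, 0] + f ![1, 1, 1]) := by
  rw [← (Fin.consEquiv fun _ : Fin 3 => Fin 2).sum_comp, Fintype.sum_prod_type, Fin.sum_univ_two,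
    sum_finTwoArrow, sum_finTwoArrow]
  rfl

theorem gramMap_eq {n : ℕ} (T : BinaryTensor (n + 1)) (i : Fin (n + 1)) :
    gramMap T i =
      (∑ a : Fin n → Fin 2, T (i.insertNth 0 a) ^ 2) * (∑ a : Fin n → Fin 2, T (i.insertNth 1 a) ^ 2)
        - (∑ a : Fin n → Fin 2, T (i.insertNth 0 a) * T (i.insertNth 1 a)) ^ 2 := by
  simp only [gramMap, Matrix.det_fin_two, gramMatrix_apply, pow_two]
  simp only [mul_comm]

theorem insertNth_zero (r a b : Fin 2) :
    (Fin.insertNth 0 r ![a, b] : Fin 3 → Fin 2) = ![r, a, b] := by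
  funext j; fin_cases j <;> rfl

theorem insertNth_one (r a b : Fin 2) :
    (Fin.insertNth 1 r ![a, b] : Fin 3 → Fin 2) = ![a, r, b] := by
  funext j; fin_cases j <;> rfl

theorem insertNth_two (r a b : Fin 2) :
    (Fin.insertNth 2 r ![a, b] : Fin 3 → Fin 2) = ![a, b, r] := by
  funext j; fin_cases j <;> rfl

/-! ### Parametrization by weight components -/

/-- The data `(N, r₀, r₁, r₂, r₃, P)` parametrize the Gram determinants: `rᵢ` are the squared moduli of
the weight components of a tensor under `SO(2)³`, and `P` is twice the real part of their product. -/
def IsParam (d : Fin 3 → ℝ) (r₀ r₁ r₂ r₃ P : ℝ) : Prop :=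
  d 0 = (r₀ + r₁ + r₂ + r₃) ^ 2 / 4 - r₀ * r₁ - r₂ * r₃ - P ∧
  d 1 = (r₀ + r₁ + r₂ + r₃) ^ 2 / 4 - r₀ * r₂ - r₁ * r₃ - P ∧
  d 2 = (r₀ + r₁ + r₂ + r₃) ^ 2 / 4 - r₀ * r₃ - r₁ * r₂ - P

theorem exists_param (T : BinaryTensor 3) :
    ∃ r₀ r₁ r₂ r₃ P : ℝ, 0 ≤ r₀ ∧ 0 ≤ r₁ ∧ 0 ≤ r₂ ∧ 0 ≤ r₃ ∧
      r₀ + r₁ + r₂ + r₃ = ∑ a, T a ^ 2 ∧ P ^ 2 ≤ 4 * (r₀ * r₁ * r₂ * r₃) ∧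
      IsParam (gramMap T) r₀ r₁ r₂ r₃ P := by
  simp only [IsParam, gramMap_eq, sum_finTwoArrow, sum_finThreeArrow, insertNth_zero,
    insertNth_one, insertNth_two]
  generalize T ![0, 0, 0] = a
  generalize T ![0, 0, 1] = b
  generalize T ![0, 1, 0] = c
  generalize T ![0, 1, 1] = e
  generalize T ![1, 0, 0] = f
  generalize T ![1, 0, 1] = k
  generalize T ![1, 1, 0] = p
  generalize T ![1, 1, 1] = q
  obtain ⟨X₀, hX₀⟩ : ∃ X, X = (a - e - k - p) / 2 := ⟨_, rfl⟩
  obtain ⟨Y₀, hY₀⟩ : ∃ X, X = -(f + c + b - q) / 2 := ⟨_, rfl⟩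
  obtain ⟨X₁, hX₁⟩ : ∃ X, X = (a - e + k + p) / 2 := ⟨_, rfl⟩
  obtain ⟨Y₁, hY₁⟩ : ∃ X, X = (-f + c + b + q) / 2 := ⟨_, rfl⟩
  obtain ⟨X₂, hX₂⟩ : ∃ X, X = (a + e - k + p) / 2 := ⟨_, rfl⟩
  obtain ⟨Y₂, hY₂⟩ : ∃ X, X = (f - c + b + q) / 2 := ⟨_, rfl⟩
  obtain ⟨X₃, hX₃⟩ : ∃ X, X = (a + e + k - p) / 2 := ⟨_, rfl⟩
  obtain ⟨Y₃, hY₃⟩ : ∃ X, X = (f + c - b + q) / 2 := ⟨_, rfl⟩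
  refine ⟨X₀ ^ 2 + Y₀ ^ 2, X₁ ^ 2 + Y₁ ^ 2, X₂ ^ 2 + Y₂ ^ 2, X₃ ^ 2 + Y₃ ^ 2,
    2 * ((X₀ * X₁ - Y₀ * Y₁) * (X₂ * X₃ - Y₂ * Y₃) - (X₀ * Y₁ + Y₀ * X₁) * (X₂ * Y₃ + Y₂ * X₃)),
    by positivity, by positivity, by positivity, by positivity, ?_, ?_, ?_, ?_, ?_⟩
  · subst_vars; ring
  -- The slack is the squared imaginary part of the product of the four components.
  · linear_combination 4 *
      sq_nonneg ((X₀ * X₁ - Y₀ * Y₁) * (X₂ * Y₃ + Y₂ * X₃) + (X₀ * Y₁ + Y₀ * X₁) * (X₂ * X₃ - Y₂ * Y₃))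
  all_goals subst_vars; ring

theorem exists_tensor {d : Fin 3 → ℝ} {r₀ r₁ r₂ r₃ P : ℝ} (h₀ : 0 ≤ r₀) (h₁ : 0 ≤ r₁)
    (h₂ : 0 ≤ r₂) (h₃ : 0 ≤ r₃) (hP : P ^ 2 ≤ 4 * (r₀ * r₁ * r₂ * r₃))
    (hd : IsParam d r₀ r₁ r₂ r₃ P) :
    ∃ T : BinaryTensor 3, ∑ a, T a ^ 2 = r₀ + r₁ + r₂ + r₃ ∧ gramMap T = d := by
  -- Three components can be taken real and nonnegative; the phase of the fourth, x + iy, realizes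
  -- P.
  obtain ⟨x, y, hxy, hx⟩ : ∃ x y : ℝ, x ^ 2 + y ^ 2 = r₀ ∧ 2 * x * (√r₁ * √r₂ * √r₃) = P := by
    have hm : (√r₁ * √r₂ * √r₃) ^ 2 = r₁ * r₂ * r₃ := by
      rw [mul_pow, mul_pow, Real.sq_sqrt h₁, Real.sq_sqrt h₂, Real.sq_sqrt h₃]
    generalize √r₁ * √r₂ * √r₃ = m at *
    by_cases h : m = 0
    · have : P ^ 2 ≤ 0 := by
        have : r₁ * r₂ * r₃ = 0 := by rw [← hm, h]; ring
        calc P ^ 2 ≤ 4 * (r₀ * r₁ * r₂ * r₃) := hP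
          _ = 4 * r₀ * (r₁ * r₂ * r₃) := by ring
          _ = 0 := by rw [this]; ring
      have hP0 : P = 0 := by nlinarith
      exact ⟨√r₀, 0, by rw [Real.sq_sqrt h₀]; ring, by rw [h, hP0]; ring⟩
    · have hm0 : 0 < m ^ 2 := by positivity
      have hle : (P / (2 * m)) ^ 2 ≤ r₀ := by
        rw [div_pow, div_le_iff₀ (by positivity)]
        calc P ^ 2 ≤ 4 * (r₀ * r₁ * r₂ * r₃) := hP
          _ = r₀ * (2 * m) ^ 2 := by linear_combination (-4 * r₀) * hm
      refine ⟨P / (2 * m), √(r₀ - (P / (2 * m)) ^ 2), ?_, ?_⟩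
      · rw [Real.sq_sqrt (by linarith)]; ring
      · field_simp
  have e₁ := Real.sq_sqrt h₁
  have e₂ := Real.sq_sqrt h₂
  have e₃ := Real.sq_sqrt h₃
  generalize √r₁ = b at *
  generalize √r₂ = c at *
  generalize √r₃ = e at *
  obtain ⟨hd0, hd1, hd2⟩ := hd
  -- Inverse of the linear change of variables in `exists_param`, with Y₁ = Y₂ = Y₃ = 0.
  let T : BinaryTensor 3 := fun a =>
    if a 0 = 0 then
      if a 1 = 0 then (if a 2 = 0 then (x + b + c + e) / 2 else -y / 2)
      else (if a 2 = 0 then -y / 2 else (-x - b + c + e) / 2)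
    else
      if a 1 = 0 then (if a 2 = 0 then -y / 2 else (-x + b - c + e) / 2)
      else (if a 2 = 0 then (-x + b + c - e) / 2 else y / 2)
  refine ⟨T, ?_, ?_⟩
  · rw [sum_finThreeArrow, ← hxy, ← e₁, ← e₂, ← e₃]
    simp [T]
    ring
  · funext i
    fin_cases i
    all_goals
      simp only [Fin.zero_eta, Fin.mk_one, Fin.reduceFinMk, gramMap_eq, sum_finTwoArrow, insertNth_zero, insertNth_one,
        insertNth_two, hd0, hd1, hd2, ← hxy, ← e₁, ← e₂, ← e₃, ← hx]
      simp [T]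
      ring

/-! ### The threshold and the pairwise inequalities -/

/-- The threshold `s + g - 1 / 2`, where `s` is the sum of the Gram determinants and `g` their
Heron form. -/
noncomputable def threshold (x y z : ℝ) : ℝ := x + y + z + heron x y z - 1 / 2

theorem threshold_sq (x y z : ℝ) :
    threshold x y z ^ 2 + 2 * ((y + z - x) * (x + z - y) * (x + y - z)) - heron x y z ^ 2 =
      (1 - 4 * x) * (1 - 4 * y) * (1 - 4 * z) / 4 := by
  simp only [threshold, heron]; ring

theorem threshold_le {x y z : ℝ} (hx : x ≤ 1 / 4) (hy : y ≤ 1 / 4) (hz : z ≤ 1 / 4) (hz0 : 0 ≤ z) :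
    threshold x y z ≤ (x - y) ^ 2 + 1 / 2 * (x + y) - 3 / 16 := by
  have : 0 ≤ (1 / 4 - z) * (z + 5 / 4 - 2 * (x + y)) := mul_nonneg (by linarith) (by linarith)
  simp only [threshold, heron]
  linarith

theorem sqrt_add_sqrt_le_one {x y : ℝ} (hx : x ≤ 1 / 4) (hy : y ≤ 1 / 4) (hx0 : 0 ≤ x)
    (hy0 : 0 ≤ y) (h : 3 / 16 ≤ (x - y) ^ 2 + 1 / 2 * (x + y)) :
    √(1 - 4 * x) + √(1 - 4 * y) ≤ 1 := by
  have e₁ := Real.sq_sqrt (show 0 ≤ 1 - 4 * x by linarith)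
  have e₂ := Real.sq_sqrt (show 0 ≤ 1 - 4 * y by linarith)
  have b₁ : √(1 - 4 * x) ≤ 1 := Real.sqrt_le_one.mpr (by linarith)
  have b₂ : √(1 - 4 * y) ≤ 1 := Real.sqrt_le_one.mpr (by linarith)
  have p₁ := Real.sqrt_nonneg (1 - 4 * x)
  have p₂ := Real.sqrt_nonneg (1 - 4 * y)
  generalize √(1 - 4 * x) = t at *
  generalize √(1 - 4 * y) = w at *
  by_contra! hlt
  have key : (x - y) ^ 2 + 1 / 2 * (x + y) - 3 / 16 =
      (1 - t - w) * ((1 - t + w) * (1 + t - w) * (1 + t + w)) / 16 := by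
    rw [show x = (1 - t ^ 2) / 4 by linarith, show y = (1 - w ^ 2) / 4 by linarith]; ring
  have hp : 0 < (1 - t + w) * (1 + t - w) * (1 + t + w) := by
    have : 0 < 1 - t + w := by
      by_contra! h'
      have : t = 1 := by linarith
      have : w = 0 := by linarith
      linarith
    have : 0 < 1 + t - w := by
      by_contra! h'
      have : t = 0 := by linarith
      linarith
    positivity
  have := mul_pos_of_neg_of_neg (show 1 - t - w < 0 by linarith) (neg_neg_of_pos hp)
  linarith

/-- In t = √(1 - 4x), w = √(1 - 4y), v = √(1 - 4z) the pairwise inequalities say that any two have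
sum at most 1. Then 16c + 8twv factors into nonnegative terms, so c < 0 forces c² ≤ (twv/2)² = ∏(1 -
4dᵢ)/4, and `threshold_sq` gives the second alternative. -/
theorem threshold_nonneg_or_eq {x y z : ℝ} (hx : x ≤ 1 / 4) (hy : y ≤ 1 / 4) (hz : z ≤ 1 / 4)
    (hx0 : 0 ≤ x) (hy0 : 0 ≤ y) (hz0 : 0 ≤ z)
    (hxy : 3 / 16 ≤ (x - y) ^ 2 + 1 / 2 * (x + y))
    (hxz : 3 / 16 ≤ (x - z) ^ 2 + 1 / 2 * (x + z))
    (hyz : 3 / 16 ≤ (y - z) ^ 2 + 1 / 2 * (y + z)) :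
    0 ≤ threshold x y z ∨
      heron x y z ^ 2 ≤ 2 * ((y + z - x) * (x + z - y) * (x + y - z)) := by
  have s₁ := sqrt_add_sqrt_le_one hx hy hx0 hy0 hxy
  have s₂ := sqrt_add_sqrt_le_one hx hz hx0 hz0 hxz
  have s₃ := sqrt_add_sqrt_le_one hy hz hy0 hz0 hyz
  have e₁ := Real.sq_sqrt (show 0 ≤ 1 - 4 * x by linarith)
  have e₂ := Real.sq_sqrt (show 0 ≤ 1 - 4 * y by linarith)
  have e₃ := Real.sq_sqrt (show 0 ≤ 1 - 4 * z by linarith)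
  have p₁ := Real.sqrt_nonneg (1 - 4 * x)
  have p₂ := Real.sqrt_nonneg (1 - 4 * y)
  have p₃ := Real.sqrt_nonneg (1 - 4 * z)
  have hsq := threshold_sq x y z
  rw [← e₁, ← e₂, ← e₃] at hsq
  generalize √(1 - 4 * x) = t at *
  generalize √(1 - 4 * y) = w at *
  generalize √(1 - 4 * z) = v at *
  have hfac : 16 * threshold x y z + 8 * (t * w * v) =
      (1 + t + w + v) * (1 + t - w - v) * (1 + w - t - v) * (1 + v - t - w) := by
    rw [threshold, heron, show x = (1 - t ^ 2) / 4 by linarith,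
      show y = (1 - w ^ 2) / 4 by linarith, show z = (1 - v ^ 2) / 4 by linarith]
    ring
  have hpos : 0 ≤ (1 + t + w + v) * (1 + t - w - v) * (1 + w - t - v) * (1 + v - t - w) := by
    have := sub_nonneg.mpr s₁
    have := sub_nonneg.mpr s₂
    have := sub_nonneg.mpr s₃
    refine mul_nonneg (mul_nonneg (mul_nonneg ?_ ?_) ?_) ?_ <;> linarith
  by_contra! hcon
  have h1 : -(t * w * v / 2) ≤ threshold x y z := by linarith
  have h2 : threshold x y z ^ 2 ≤ (t * w * v / 2) ^ 2 :=
    sq_le_sq' h1 (by have : 0 ≤ t * w * v := by positivity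
                     linarith [hcon.1])
  nlinarith

/-- If x + y < z ≤ 1/4, the left side is at most (x + y)² + (x + y)/2 < 1/16 + 1/8. -/
theorem triangle_of_separated {x y z : ℝ} (hx0 : 0 ≤ x) (hy0 : 0 ≤ y) (hz : z ≤ 1 / 4)
    (hxy : 3 / 16 ≤ (x - y) ^ 2 + 1 / 2 * (x + y)) : 0 ≤ x + y - z := by
  by_contra! h
  nlinarith [mul_nonneg hx0 hy0]

theorem triangle_of_prod_nonneg {x y z : ℝ} (hx0 : 0 ≤ x) (hy0 : 0 ≤ y)
    (h : 0 ≤ (y + z - x) * (x + z - y) * (x + y - z)) : 0 ≤ x + y - z := by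
  by_contra! hlt
  have : 0 < (y + z - x) * (x + z - y) := mul_pos (by linarith) (by linarith)
  linarith [mul_neg_of_pos_of_neg this hlt]

/-! ### Sufficiency: constructing a tensor of norm 1 -/

/-- A point of the cube with a suitable auxiliary value `ζ` lies in the Gram locus. -/
theorem mem_gramLocus_of_aux {d : Fin 3 → ℝ} {ζ : ℝ}
    (h0 : 0 ≤ ζ + (d 1 + d 2 - d 0)) (h1 : 0 ≤ ζ + (d 0 + d 2 - d 1))
    (h2 : 0 ≤ ζ + (d 0 + d 1 - d 2))
    (b0 : ζ + (d 1 + d 2 - d 0) ≤ 1 / 2) (b1 : ζ + (d 0 + d 2 - d 1) ≤ 1 / 2)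
    (b2 : ζ + (d 0 + d 1 - d 2) ≤ 1 / 2)
    (h : (ζ ^ 2 + ζ - heron (d 0) (d 1) (d 2)) ^ 2 ≤
      2 * ((ζ + (d 1 + d 2 - d 0)) * (ζ + (d 0 + d 2 - d 1)) * (ζ + (d 0 + d 1 - d 2)))) :
    d ∈ gramLocus 3 := by
  -- u, v, w are to be r₀ + r₁ - r₂ - r₃ and its two analogues, with ∑ rᵢ = 1.
  obtain ⟨u, hu0, hu1, hu⟩ : ∃ u : ℝ, 0 ≤ u ∧ u ≤ 1 ∧ u ^ 2 = 2 * (ζ + (d 1 + d 2 - d 0)) :=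
    ⟨_, Real.sqrt_nonneg _, Real.sqrt_le_one.mpr (by linarith), Real.sq_sqrt (by linarith)⟩
  obtain ⟨v, hv0, hv1, hv⟩ : ∃ u : ℝ, 0 ≤ u ∧ u ≤ 1 ∧ u ^ 2 = 2 * (ζ + (d 0 + d 2 - d 1)) :=
    ⟨_, Real.sqrt_nonneg _, Real.sqrt_le_one.mpr (by linarith), Real.sq_sqrt (by linarith)⟩
  obtain ⟨w, hw0, hw1, hw⟩ : ∃ u : ℝ, 0 ≤ u ∧ u ≤ 1 ∧ u ^ 2 = 2 * (ζ + (d 0 + d 1 - d 2)) :=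
    ⟨_, Real.sqrt_nonneg _, Real.sqrt_le_one.mpr (by linarith), Real.sq_sqrt (by linarith)⟩
  obtain ⟨P, hPdef⟩ : ∃ P : ℝ, P = (1 + 2 * ζ - 2 * (d 0 + d 1 + d 2)) / 8 := ⟨_, rfl⟩
  have hψ : ζ ^ 2 + ζ - heron (d 0) (d 1) (d 2) ≤ u * v * w / 2 := by
    refine le_of_sq_le_sq ?_ (by positivity)
    refine h.trans (le_of_eq ?_)
    rw [div_pow, mul_pow, mul_pow, hu, hv, hw]; ring
  have ed0 : d 0 = (1 + v ^ 2 + w ^ 2 - u ^ 2) / 8 - P := by rw [hu, hv, hw, hPdef]; ring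
  have ed1 : d 1 = (1 + u ^ 2 + w ^ 2 - v ^ 2) / 8 - P := by rw [hu, hv, hw, hPdef]; ring
  have ed2 : d 2 = (1 + u ^ 2 + v ^ 2 - w ^ 2) / 8 - P := by rw [hu, hv, hw, hPdef]; ring
  have eζ : ζ = P - 1 / 8 + (u ^ 2 + v ^ 2 + w ^ 2) / 8 := by rw [hu, hv, hw, hPdef]; ring
  have hP : 64 * P ^ 2 ≤ (1 + u + v + w) * (1 + u - v - w) * (1 - u + v - w) * (1 - u - v + w) := by
    rw [eζ, heron, ed0, ed1, ed2] at hψ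
    linear_combination 16 * hψ
  have hprod : 0 ≤ (1 + u + v + w) * (1 + u - v - w) * (1 - u + v - w) * (1 - u - v + w) :=
    le_trans (by positivity) hP
  -- Any two of the last three factors have nonnegative sum, so a negative one would be the only one
  -- and the product would be negative.
  have aux : ∀ {a b c : ℝ}, 0 ≤ b → 0 ≤ c → 0 ≤ a → a ≤ 1 → b ≤ 1 → c ≤ 1 →
      0 ≤ (1 + a + b + c) * (1 + a - b - c) * (1 - a + b - c) * (1 - a - b + c) →
      0 ≤ 1 + a - b - c := by
    intro a b c hb hc ha ha1 hb1 hc1 hp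
    by_contra! hlt
    have p1 : 0 < 1 - a + b - c := by linarith
    have p2 : 0 < 1 - a - b + c := by linarith
    have p3 : 0 < 1 + a + b + c := by linarith
    have := mul_neg_of_pos_of_neg (mul_pos (mul_pos p1 p2) p3) hlt
    linarith
  have r1 := aux hv0 hw0 hu0 hu1 hv1 hw1 hprod
  have r2 := aux hu0 hw0 hv0 hv1 hu1 hw1 (by linarith)
  have r3 := aux hu0 hv0 hw0 hw1 hu1 hv1 (by linarith)
  obtain ⟨T, hT, hG⟩ := exists_tensor (d := d) (r₀ := (1 + u + v + w) / 4)
    (r₁ := (1 + u - v - w) / 4) (r₂ := (1 - u + v - w) / 4) (r₃ := (1 - u - v + w) / 4) (P := P)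
    (by linarith) (by linarith) (by linarith) (by linarith) (by linarith)
    ⟨by rw [ed0]; ring, by rw [ed1]; ring, by rw [ed2]; ring⟩
  exact ⟨T, by rw [unitBall, Set.mem_ofPred_eq, hT]; linarith, hG⟩

theorem mem_gramLocus_of_threshold {d : Fin 3 → ℝ} (hd : ∀ i, 0 ≤ d i ∧ d i ≤ 1 / 4)
    (h0 : 0 ≤ d 1 + d 2 - d 0) (h1 : 0 ≤ d 0 + d 2 - d 1) (h2 : 0 ≤ d 0 + d 1 - d 2)
    (hc : 0 ≤ threshold (d 0) (d 1) (d 2)) : d ∈ gramLocus 3 := by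
  obtain ⟨hx0, hx⟩ := hd 0
  obtain ⟨hy0, hy⟩ := hd 1
  obtain ⟨hz0, hz⟩ := hd 2
  have hs := Real.sq_sqrt hc
  have hs0 := Real.sqrt_nonneg (threshold (d 0) (d 1) (d 2))
  generalize √(threshold (d 0) (d 1) (d 2)) = ζ at *
  have aux : ∀ {a b : ℝ}, a ≤ 1 / 4 → b ≤ 1 / 4 → 1 / 4 ≤ (1 - 2 * a) * (1 - 2 * b) := by
    intro a b ha hb
    nlinarith [mul_nonneg (sub_nonneg.mpr ha) (sub_nonneg.mpr hb)]
  have up : ∀ l : ℝ, l ≤ 1 / 2 → ζ ^ 2 ≤ (1 / 2 - l) ^ 2 → ζ + l ≤ 1 / 2 := by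
    intro l hl h
    linarith [le_of_sq_le_sq h (by linarith)]
  have hfac : 0 ≤ (1 - 4 * d 0) * (1 - 4 * d 1) * (1 - 4 * d 2) / 4 := by
    have h4 : ∀ i, 0 ≤ 1 - 4 * d i := fun i => by linarith [(hd i).2]
    have := h4 0
    have := h4 1
    have := h4 2
    positivity
  have hsq := threshold_sq (d 0) (d 1) (d 2)
  refine mem_gramLocus_of_aux (ζ := ζ) (by linarith) (by linarith) (by linarith)
    (up _ (by linarith) ?_) (up _ (by linarith) ?_) (up _ (by linarith) ?_) ?_
  · rw [hs, threshold, heron]; linarith [aux hy hz]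
  · rw [hs, threshold, heron]; linarith [aux hx hz]
  · rw [hs, threshold, heron]; linarith [aux hx hy]
  -- At ζ² = c the even quartic attains its maximum ∏(1 - 4dᵢ)/4.
  · have hquartic : 2 * ((ζ + (d 1 + d 2 - d 0)) * (ζ + (d 0 + d 2 - d 1)) *
        (ζ + (d 0 + d 1 - d 2))) - (ζ ^ 2 + ζ - heron (d 0) (d 1) (d 2)) ^ 2 =
        (1 - 4 * d 0) * (1 - 4 * d 1) * (1 - 4 * d 2) / 4 -
          (ζ ^ 2 - threshold (d 0) (d 1) (d 2)) ^ 2 := by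
      simp only [threshold, heron]; ring
    rw [hs, sub_self] at hquartic
    rw [hs]
    linarith

theorem gramLocus_superset {d : Fin 3 → ℝ} (hd : ∀ i, 0 ≤ d i ∧ d i ≤ 1 / 4)
    (h : Q₂ d ≤ Q₁ d ∨ (Q₁ d ≤ Q₂ d ∧
      ∀ i j : Fin 3, i ≠ j → 3 / 16 ≤ (d i - d j) ^ 2 + (1 / 2) * (d i + d j))) :
    d ∈ gramLocus 3 := by
  obtain ⟨hx0, hx⟩ := hd 0
  obtain ⟨hy0, hy⟩ := hd 1
  obtain ⟨hz0, hz⟩ := hd 2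
  rw [Q₁_three, Q₂_three d fun i => (hd i).1] at h
  have first : heron (d 0) (d 1) (d 2) ^ 2 / 2 ≤
      (d 1 + d 2 - d 0) * (d 0 + d 2 - d 1) * (d 0 + d 1 - d 2) → d ∈ gramLocus 3 := by
    intro h
    have hQ : 0 ≤ (d 1 + d 2 - d 0) * (d 0 + d 2 - d 1) * (d 0 + d 1 - d 2) :=
      le_trans (by positivity) h
    have l2 := triangle_of_prod_nonneg hx0 hy0 hQ
    have l1 := triangle_of_prod_nonneg (z := d 1) hx0 hz0 (by linarith)
    have l0 := triangle_of_prod_nonneg (z := d 0) hy0 hz0 (by linarith)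
    refine mem_gramLocus_of_aux (ζ := 0) ?_ ?_ ?_ ?_ ?_ ?_ ?_ <;> linarith
  rcases h with h | ⟨-, hf⟩
  · exact first h
  · have f01 := hf 0 1 (by decide)
    have f02 := hf 0 2 (by decide)
    have f12 := hf 1 2 (by decide)
    rcases threshold_nonneg_or_eq hx hy hz hx0 hy0 hz0 f01 f02 f12 with hc | he
    · exact mem_gramLocus_of_threshold hd (triangle_of_separated hy0 hz0 hx f12)
        (triangle_of_separated hx0 hz0 hy f02) (triangle_of_separated hx0 hy0 hz f01) hc
    · exact first (by linarith)

/-! ### Necessity: tensors of norm at most 1 -/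

/-- Increasing the norm to `1` keeps the threshold nonnegative. -/
theorem threshold_nonneg_of_scaled {x y z M : ℝ} (hx : 4 * x ≤ M) (hy : 4 * y ≤ M)
    (hz : 4 * z ≤ M) (hM0 : 0 ≤ M) (hM : M ≤ 1)
    (hQ0 : 0 ≤ (y + z - x) * (x + z - y) * (x + y - z))
    (hQ : 2 * ((y + z - x) * (x + z - y) * (x + y - z)) < heron x y z ^ 2)
    (h : 0 ≤ 2 * (x + y + z) * M + 2 * heron x y z - M ^ 2) : 0 ≤ threshold x y z := by
  by_contra! hlt
  have hcont : ContinuousOn (fun t : ℝ => 2 * (x + y + z) * t + 2 * heron x y z - t ^ 2)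
      (Set.Icc M 1) := by fun_prop
  obtain ⟨t, ⟨htM, ht1⟩, ht⟩ := intermediate_value_Icc' hM hcont
    (show (0 : ℝ) ∈ _ from ⟨by simp only [threshold] at hlt; linarith, h⟩)
  -- Homogenized `threshold_sq`: at a root t in [M, 1] it yields g² ≤ 2tQ₁ ≤ 2Q₁, contrary to `hQ`.
  have hfac : (2 * (x + y + z) * t + 2 * heron x y z - t ^ 2) ^ 2 / 4 +
      2 * t * ((y + z - x) * (x + z - y) * (x + y - z)) - heron x y z ^ 2 =
      t * ((t - 4 * x) * (t - 4 * y) * (t - 4 * z)) / 4 := by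
    simp only [heron]; ring
  have hpos : 0 ≤ t * ((t - 4 * x) * (t - 4 * y) * (t - 4 * z)) / 4 := by
    have : 0 ≤ t := by linarith
    have : 0 ≤ t - 4 * x := by linarith
    have : 0 ≤ t - 4 * y := by linarith
    have : 0 ≤ t - 4 * z := by linarith
    positivity
  simp only at ht
  rw [ht] at hfac
  nlinarith [mul_nonneg (sub_nonneg.mpr ht1) hQ0]

theorem scaled_nonneg_of_sq_le {x y z M ζ : ℝ}
    (hQ : 2 * M * ((y + z - x) * (x + z - y) * (x + y - z)) < heron x y z ^ 2)
    (h : (ζ ^ 2 + M * ζ - heron x y z) ^ 2 ≤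
      2 * M * ((ζ + (y + z - x)) * (ζ + (x + z - y)) * (ζ + (x + y - z)))) :
    0 ≤ 2 * (x + y + z) * M + 2 * heron x y z - M ^ 2 := by
  have hquartic : 2 * M * ((ζ + (y + z - x)) * (ζ + (x + z - y)) * (ζ + (x + y - z))) -
      (ζ ^ 2 + M * ζ - heron x y z) ^ 2 =
      -ζ ^ 4 + (2 * (x + y + z) * M + 2 * heron x y z - M ^ 2) * ζ ^ 2 +
        (2 * M * ((y + z - x) * (x + z - y) * (x + y - z)) - heron x y z ^ 2) := by
    simp only [heron]; ring
  by_contra! hlt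
  have : (2 * (x + y + z) * M + 2 * heron x y z - M ^ 2) * ζ ^ 2 ≤ 0 :=
    mul_nonpos_of_nonpos_of_nonneg hlt.le (sq_nonneg ζ)
  have : 0 ≤ ζ ^ 4 := by positivity
  linarith

/-- The constraint on P is one-sided and can be squared only when its left side is nonnegative. If
that side is negative, then g ≤ 0 and ζ ≤ 0, so it vanishes at some t in [ζ, 0], where the squared
inequality holds trivially. -/
theorem scaled_nonneg_of_le {x y z N ζ K : ℝ}
    (l0 : 0 ≤ y + z - x) (l1 : 0 ≤ x + z - y) (l2 : 0 ≤ x + y - z)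
    (h0 : 0 ≤ ζ + (y + z - x)) (h1 : 0 ≤ ζ + (x + z - y)) (h2 : 0 ≤ ζ + (x + y - z))
    (hQ : 2 * N ^ 2 * ((y + z - x) * (x + z - y) * (x + y - z)) < heron x y z ^ 2)
    (hK : K ^ 2 = 2 * ((ζ + (y + z - x)) * (ζ + (x + z - y)) * (ζ + (x + y - z))))
    (h : ζ ^ 2 + N ^ 2 * ζ - heron x y z ≤ N * K) :
    0 ≤ 2 * (x + y + z) * N ^ 2 + 2 * heron x y z - (N ^ 2) ^ 2 := by
  rcases le_or_gt 0 (ζ ^ 2 + N ^ 2 * ζ - heron x y z) with hψ | hψ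
  · refine scaled_nonneg_of_sq_le hQ (ζ := ζ) ?_
    calc (ζ ^ 2 + N ^ 2 * ζ - heron x y z) ^ 2 ≤ (N * K) ^ 2 := by gcongr
      _ = _ := by rw [mul_pow, hK]; ring
  · have hg : heron x y z ≤ 0 := by
      have : heron x y z = -((y + z - x) * (x + z - y) + (y + z - x) * (x + y - z) +
        (x + z - y) * (x + y - z)) := by rw [heron]; ring
      rw [this]
      exact neg_nonpos.mpr (by positivity)
    have hζ : ζ ≤ 0 := by
      by_contra! hpos
      have : 0 ≤ N ^ 2 * ζ := by positivity
      nlinarith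
    have hcont : ContinuousOn (fun t : ℝ => t ^ 2 + N ^ 2 * t - heron x y z) (Set.Icc ζ 0) := by
      fun_prop
    obtain ⟨t, ⟨htζ, -⟩, ht⟩ := intermediate_value_Icc hζ hcont
      (show (0 : ℝ) ∈ _ from ⟨hψ.le, by linarith⟩)
    simp only at ht
    refine scaled_nonneg_of_sq_le hQ (ζ := t) ?_
    rw [ht]
    have : 0 ≤ t + (y + z - x) := by linarith
    have : 0 ≤ t + (x + z - y) := by linarith
    have : 0 ≤ t + (x + y - z) := by linarith
    rw [zero_pow two_ne_zero]
    positivity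

theorem abs_le_of_param {a b P : ℝ} (ha : 0 ≤ a) (hb : 0 ≤ b) (hP : P ^ 2 ≤ 4 * (a * b)) :
    |P| ≤ a + b :=
  abs_le_of_sq_le_sq (by nlinarith [sq_nonneg (a - b)]) (by positivity)

theorem gramLocus_subset {d : Fin 3 → ℝ} (hd : d ∈ gramLocus 3) :
    (∀ i, 0 ≤ d i ∧ d i ≤ 1 / 4) ∧ (Q₂ d ≤ Q₁ d ∨ (Q₁ d ≤ Q₂ d ∧
      ∀ i j : Fin 3, i ≠ j → 3 / 16 ≤ (d i - d j) ^ 2 + (1 / 2) * (d i + d j))) := by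
  obtain ⟨T, hT, rfl⟩ := hd
  obtain ⟨r₀, r₁, r₂, r₃, P, h₀, h₁, h₂, h₃, hN, hP, e0, e1, e2⟩ := exists_param T
  rw [unitBall, Set.mem_ofPred_eq, ← hN] at hT
  generalize gramMap T = d at *
  obtain ⟨N, hNdef⟩ : ∃ N, N = r₀ + r₁ + r₂ + r₃ := ⟨_, rfl⟩
  have hN0 : 0 ≤ N := by rw [hNdef]; positivity
  have hN1 : N ≤ 1 := by rw [hNdef]; exact hT
  have hM1 : N ^ 2 ≤ 1 := pow_le_one₀ hN0 hN1
  obtain ⟨lo01, hi01⟩ := abs_le.mp (abs_le_of_param (mul_nonneg h₀ h₁) (mul_nonneg h₂ h₃)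
    (hP.trans_eq (by ring)))
  obtain ⟨lo02, hi02⟩ := abs_le.mp (abs_le_of_param (mul_nonneg h₀ h₂) (mul_nonneg h₁ h₃)
    (hP.trans_eq (by ring)))
  obtain ⟨lo03, hi03⟩ := abs_le.mp (abs_le_of_param (mul_nonneg h₀ h₃) (mul_nonneg h₁ h₂)
    (hP.trans_eq (by ring)))
  have l0 : 0 ≤ d 1 + d 2 - d 0 := by
    rw [e0, e1, e2]; linarith [sq_nonneg (r₀ + r₁ - r₂ - r₃)]
  have l1 : 0 ≤ d 0 + d 2 - d 1 := by
    rw [e0, e1, e2]; linarith [sq_nonneg (r₀ + r₂ - r₁ - r₃)]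
  have l2 : 0 ≤ d 0 + d 1 - d 2 := by
    rw [e0, e1, e2]; linarith [sq_nonneg (r₀ + r₃ - r₁ - r₂)]
  have m0 : 4 * d 0 ≤ N ^ 2 := by rw [e0, hNdef]; linarith
  have m1 : 4 * d 1 ≤ N ^ 2 := by rw [e1, hNdef]; linarith
  have m2 : 4 * d 2 ≤ N ^ 2 := by rw [e2, hNdef]; linarith
  have hd : ∀ i, 0 ≤ d i ∧ d i ≤ 1 / 4 := by
    intro i
    fin_cases i <;>
      simp only [Fin.zero_eta, Fin.mk_one, Fin.reduceFinMk] <;> constructor <;> linarith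
  refine ⟨hd, or_iff_not_imp_left.mpr fun hQ => ?_⟩
  rw [not_le] at hQ
  refine ⟨hQ.le, ?_⟩
  rw [Q₁_three, Q₂_three d fun i => (hd i).1] at hQ
  have hQ0 : 0 ≤ (d 1 + d 2 - d 0) * (d 0 + d 2 - d 1) * (d 0 + d 1 - d 2) := by positivity
  -- Chosen to make the three shifted forms half squares; `mem_gramLocus_of_aux` inverts this for N
  -- = 1.
  obtain ⟨ζ, hζ⟩ : ∃ ζ, ζ = 4 * P - N ^ 2 / 2 + (d 0 + d 1 + d 2) := ⟨_, rfl⟩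
  have v0 : ζ + (d 1 + d 2 - d 0) = (r₀ + r₁ - r₂ - r₃) ^ 2 / 2 := by
    rw [hζ, e0, e1, e2, hNdef]; ring
  have v1 : ζ + (d 0 + d 2 - d 1) = (r₀ + r₂ - r₁ - r₃) ^ 2 / 2 := by
    rw [hζ, e0, e1, e2, hNdef]; ring
  have v2 : ζ + (d 0 + d 1 - d 2) = (r₀ + r₃ - r₁ - r₂) ^ 2 / 2 := by
    rw [hζ, e0, e1, e2, hNdef]; ring
  have hscaled := scaled_nonneg_of_le (x := d 0) (y := d 1) (z := d 2) (N := N) (ζ := ζ)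
    (K := (r₀ + r₁ - r₂ - r₃) * (r₀ + r₂ - r₁ - r₃) * (r₀ + r₃ - r₁ - r₂) / 2) l0 l1 l2
    (by rw [v0]; positivity) (by rw [v1]; positivity) (by rw [v2]; positivity)
    (by nlinarith [mul_nonneg (sub_nonneg.mpr hM1) hQ0]) (by rw [v0, v1, v2]; ring)
    (by
      rw [hζ, heron, e0, e1, e2, hNdef]
      linear_combination 4 * hP)
  have hc := threshold_nonneg_of_scaled m0 m1 m2 (sq_nonneg N) hM1 hQ0 (by linarith) hscaled
  obtain ⟨hx0, hx⟩ := hd 0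
  obtain ⟨hy0, hy⟩ := hd 1
  obtain ⟨hz0, hz⟩ := hd 2
  have f01 := hc.trans (threshold_le hx hy hz hz0)
  have f02 := hc.trans ((by simp only [threshold, heron]; linarith :
    threshold (d 0) (d 1) (d 2) ≤ threshold (d 0) (d 2) (d 1)).trans (threshold_le hx hz hy hy0))
  have f12 := hc.trans ((by simp only [threshold, heron]; linarith :
    threshold (d 0) (d 1) (d 2) ≤ threshold (d 1) (d 2) (d 0)).trans (threshold_le hy hz hx hx0))
  intro i j hij
  fin_cases i <;> fin_cases j <;>
    first
    | exact absurd rfl hij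
    | (simp only [Fin.zero_eta, Fin.mk_one, Fin.reduceFinMk]; linarith)

end GramLocus

theorem theorem1p4 :
    GramLocus.gramLocus 3 =
      {d : Fin 3 → ℝ | (∀ i, 0 ≤ d i ∧ d i ≤ 1 / 4) ∧
        (GramLocus.Q₂ d ≤ GramLocus.Q₁ d ∨
          (GramLocus.Q₁ d ≤ GramLocus.Q₂ d ∧
            ∀ i j : Fin 3, i ≠ j → 3 / 16 ≤ (d i - d j) ^ 2 + (1 / 2) * (d i + d j)))} :=
  Set.Subset.antisymm (fun _ hd => GramLocus.gramLocus_subset hd)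
    fun _ hd => GramLocus.gramLocus_superset hd.1 hd.2
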